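/- Let $O(-2)=\Lambda^1\mathbb{C}P^1$ be the total space of the canonical line bundle over $\mathbb{C}P^1$, covered by the two charts $(z,\xi)$ and $(w,\eta)$ in $\mathbb{C}^2$, glued by $w=1/z$, $\eta=z^2\xi$. For $c>0$ let $g_{EH}$ be the Eguchi--Hanson metric on $O(-2)$, i.e. the K\"ahler metric whose associated K\"ahler form is $\frac{i}{2\pi}\partial\bar\partial\Psi$, where in either chart $$\Psi(z,\xi)=\log(1+|z|^2)+u\big((1+|z|^2)^2|\xi|^2\big),\qquad u(x)=\sqrt{1+cx}-1-\log\frac{\sqrt{1+cx}+1}{2}.$$ (It is Ricci-flat and restricts to the Fubini--Study metric on the zero section; $c$ only reflects a rescaling of the fibre coordinate.) A K\"ahler metric $g$ on a complex manifold $M$ is called projectively induced if there is a K\"ahler (holomorphic and isometric) immersion of $(M,g)$ into $(\mathbb{C}P^N,g_{FS})$ for some $N\le\infty$, where $\mathbb{C}P^\infty$ is the projective space of $\ell^2(\mathbb{C})$ and $g_{FS}$ is the Fubini--Study metric, with K\"ahler form $\omega_{FS}=\frac{i}{2\pi}\partial\bar\partial\log(|Z_0|^2+\cdots+|Z_N|^2)$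 in homogeneous coordinates. Then, for every $c>0$ and every positive integer $m$, the metric $m\,g_{EH}$ is not projectively induced. -/

import Mathlib

open scoped Manifold ContDiff Topology

/-! ### Kähler metrics given by potentials -/

section Potential

variable {E : Type*} [NormedAddCommGroup E] [NormedSpace ℂ E]

/-- The Riemannian metric, evaluated on the tangent vectors `v`, `w` at `p`, whose associated Kähler
form is `ω = (i / 2π) ∂∂̄ φ`, with the convention `g (v, w) = ω (v, J w)`.
In linear coordinates it is `(1 / π) * Re (∑ φ_{j k̄} v_j w̄_k)`, and
`Re (∑ φ_{j k̄} v_j w̄_k) = (D²φ (v, w) + D²φ (i v, i w)) / 4`. -/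
noncomputable def potentialMetric (φ : E → ℝ) (p v w : E) : ℝ :=
  1 / (4 * Real.pi) *
    (fderiv ℝ (fderiv ℝ φ) p v w +
      fderiv ℝ (fderiv ℝ φ) p (Complex.I • v) (Complex.I • w))

end Potential

/-! ### Kähler immersions into complex projective spaces -/

section Immersion

variable {H : Type*} [NormedAddCommGroup H] [InnerProductSpace ℂ H]

/-- The Fubini–Study metric of the projective space of `H` in homogeneous coordinates `Z`, that is,
its pull-back to `H \ {0}`: the associated form is `(i / 2π) ∂∂̄ log ‖Z‖²`. -/
noncomputable def fubiniStudy (Z a b : H) : ℝ :=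
  potentialMetric (fun Y : H => Real.log (‖Y‖ ^ 2)) Z a b

variable {E : Type*} [NormedAddCommGroup E] [NormedSpace ℂ E]
  {M : Type*} [TopologicalSpace M] [ChartedSpace E M]

variable (E M) in
/-- Fields of real-valued forms in two tangent vectors on a complex manifold `M` modelled on `E`. -/
abbrev MetricTensor : Type _ :=
  (p : M) → TangentSpace 𝓘(ℂ, E) p → TangentSpace 𝓘(ℂ, E) p → ℝ

variable (E) in
/-- `F` is, near `p`, a holomorphic nowhere vanishing lift to `H` of the map `f` into the projective
space of `H`. -/
def IsHolomorphicLift (f : M → Projectivization ℂ H) (F : M → H) (p : M) : Prop :=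
  ∀ᶠ q in 𝓝 p, MDifferentiableAt 𝓘(ℂ, E) 𝓘(ℂ, H) F q ∧
    ∃ h : F q ≠ 0, f q = Projectivization.mk ℂ (F q) h

/-- `f` is a holomorphic map of the complex manifold `M` into the projective space of `H` which
pulls back the Fubini–Study metric to `g`. When `g` is positive definite, such an `f` is
automatically an immersion. -/
structure IsKahlerImmersion [IsManifold 𝓘(ℂ, E) ω M] (g : MetricTensor E M)
    (f : M → Projectivization ℂ H) : Prop where
  holomorphic : ∀ p : M, ∃ F : M → H, IsHolomorphicLift E f F p
  isometric : ∀ (p : M) (F : M → H), IsHolomorphicLift E f F p →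
    ∀ v w : TangentSpace 𝓘(ℂ, E) p,
      fubiniStudy (F p) (mfderiv 𝓘(ℂ, E) 𝓘(ℂ, H) F p v) (mfderiv 𝓘(ℂ, E) 𝓘(ℂ, H) F p w) = g p v w

/-- `g` is projectively induced: there is a Kähler immersion of `(M, g)` into `ℂP^N` for some finite
`N`, or into `ℂP^∞`, the projective space of `ℓ²(ℂ)`. -/
def ProjectivelyInduced [IsManifold 𝓘(ℂ, E) ω M] (g : MetricTensor E M) : Prop :=
  (∃ (N : ℕ) (f : M → Projectivization ℂ (EuclideanSpace ℂ (Fin (N + 1)))),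
    IsKahlerImmersion g f) ∨
  ∃ f : M → Projectivization ℂ (lp (fun _ : ℕ => ℂ) 2), IsKahlerImmersion g f

end Immersion

/-! ### The total space of `O(-2)` over `ℂP¹` -/

/-- Pairs `(Z, t)` with `Z ∈ ℂ² \ {0}` and `t ∈ ℂ`. -/
abbrev PreO2 : Type := {Z : ℂ × ℂ // Z ≠ 0} × ℂ

/-- `(λ Z, t) ∼ (Z, λ² t)` for `λ ∈ ℂ \ {0}`: the pair `(Z, t)` represents the point `t • (Z ⊗ Z)`
of the fibre `ℓ ⊗ ℓ` of `O(-2)` over the line `ℓ = ℂ Z`. -/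
def setoidO2 : Setoid PreO2 where
  r a b := ∃ l : ℂ, l ≠ 0 ∧ (a.1 : ℂ × ℂ) = l • (b.1 : ℂ × ℂ) ∧ b.2 = l ^ 2 * a.2
  iseqv :=
    { refl := fun a => ⟨1, one_ne_zero, by simp, by simp⟩
      symm := by
        rintro a b ⟨l, hl, h1, h2⟩
        refine ⟨l⁻¹, inv_ne_zero hl, ?_, ?_⟩
        · rw [h1, smul_smul, inv_mul_cancel₀ hl, one_smul]
        · rw [h2]; field_simp
      trans := by
        rintro a b c ⟨l, hl, h1, h2⟩ ⟨k, hk, h3, h4⟩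
        refine ⟨l * k, mul_ne_zero hl hk, ?_, ?_⟩
        · rw [h1, h3, smul_smul]
        · rw [h4, h2]; ring }

/-- The total space of the line bundle `O(-2) = Λ¹ℂP¹` over `ℂP¹`, as the quotient of
`(ℂ² \ {0}) × ℂ` by `ℂ \ {0}`. -/
def O2 : Type := Quotient setoidO2

namespace O2

/-- It carries the quotient topology. -/
instance : TopologicalSpace O2 :=
  inferInstanceAs (TopologicalSpace (Quotient setoidO2))

/-- The point of `O(-2)` represented by `(Z, t)`. -/
def mk (a : PreO2) : O2 := Quotient.mk setoidO2 a

theorem isQuotientMap_mk : Topology.IsQuotientMap mk := isQuotientMap_quotient_mk'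

theorem mk_eq_mk {a b : PreO2} : mk a = mk b ↔
    ∃ l : ℂ, l ≠ 0 ∧ (a.1 : ℂ × ℂ) = l • (b.1 : ℂ × ℂ) ∧ b.2 = l ^ 2 * a.2 :=
  Quotient.eq (r := setoidO2)

/-- The open subset `Z₀ ≠ 0`. -/
def U0 : Set O2 := {p | Quotient.liftOn p (fun a : PreO2 => a.1.1.1 ≠ 0) (by
  rintro a b ⟨l, hl, h1, -⟩
  simp [h1, hl])}

/-- The open subset `Z₁ ≠ 0`. -/
def U1 : Set O2 := {p | Quotient.liftOn p (fun a : PreO2 => a.1.1.2 ≠ 0) (by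
  rintro a b ⟨l, hl, h1, -⟩
  simp [h1, hl])}

theorem mk_mem_U0 {a : PreO2} : mk a ∈ U0 ↔ a.1.1.1 ≠ 0 := Iff.rfl

theorem mk_mem_U1 {a : PreO2} : mk a ∈ U1 ↔ a.1.1.2 ≠ 0 := Iff.rfl

theorem isOpen_U0 : IsOpen U0 := by
  rw [← isQuotientMap_mk.isOpen_preimage]
  have : mk ⁻¹' U0 = {a : PreO2 | a.1.1.1 ≠ 0} := rfl
  rw [this]
  exact isOpen_ne_fun (by fun_prop) continuous_const

theorem isOpen_U1 : IsOpen U1 := by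
  rw [← isQuotientMap_mk.isOpen_preimage]
  have : mk ⁻¹' U1 = {a : PreO2 | a.1.1.2 ≠ 0} := rfl
  rw [this]
  exact isOpen_ne_fun (by fun_prop) continuous_const

theorem mem_U1_of_not_mem_U0 {p : O2} (h : p ∉ U0) : p ∈ U1 := by
  obtain ⟨a, rfl⟩ := isQuotientMap_mk.surjective p
  rw [mk_mem_U0, not_not] at h
  rw [mk_mem_U1]
  intro h2
  exact a.1.2 (Prod.ext h h2)

/-- The coordinates `(z, ξ) = (Z₁ / Z₀, t Z₀²)`. -/
noncomputable def coord0 (p : O2) : ℂ × ℂ :=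
  Quotient.liftOn p (fun a : PreO2 => (a.1.1.2 / a.1.1.1, a.2 * a.1.1.1 ^ 2)) (by
    rintro a b ⟨l, hl, h1, h2⟩
    simp only [h1, h2, Prod.smul_fst, Prod.smul_snd, smul_eq_mul]
    rw [mul_div_mul_left _ _ hl]
    ring_nf)

/-- The coordinates `(w, η) = (Z₀ / Z₁, t Z₁²)`. -/
noncomputable def coord1 (p : O2) : ℂ × ℂ :=
  Quotient.liftOn p (fun a : PreO2 => (a.1.1.1 / a.1.1.2, a.2 * a.1.1.2 ^ 2)) (by
    rintro a b ⟨l, hl, h1, h2⟩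
    simp only [h1, h2, Prod.smul_fst, Prod.smul_snd, smul_eq_mul]
    rw [mul_div_mul_left _ _ hl]
    ring_nf)

/-- The point with coordinates `(z, ξ)` in the first chart. -/
def point0 (x : ℂ × ℂ) : O2 := mk (⟨(1, x.1), by simp⟩, x.2)

/-- The point with coordinates `(w, η)` in the second chart. -/
def point1 (x : ℂ × ℂ) : O2 := mk (⟨(x.1, 1), by simp⟩, x.2)

theorem continuous_point0 : Continuous point0 := by
  refine isQuotientMap_mk.continuous.comp ?_
  fun_prop

theorem continuous_point1 : Continuous point1 := by
  refine isQuotientMap_mk.continuous.comp ?_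
  fun_prop

/-- The chart `[Z₀ : Z₁ ; t] ↦ (Z₁ / Z₀, t Z₀²)` on `Z₀ ≠ 0`. -/
noncomputable def chart0 : OpenPartialHomeomorph O2 (ℂ × ℂ) where
  toFun := coord0
  invFun := point0
  source := U0
  target := Set.univ
  map_source' := fun _ _ => Set.mem_univ _
  map_target' := fun _ _ => mk_mem_U0.2 one_ne_zero
  left_inv' := by
    intro p hp
    obtain ⟨⟨⟨Z, hZ⟩, t⟩, rfl⟩ := isQuotientMap_mk.surjective p
    rw [mk_mem_U0] at hp
    refine mk_eq_mk.2 ⟨Z.1⁻¹, inv_ne_zero hp, ?_, ?_⟩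
    · refine Prod.ext ?_ ?_
      · simpa using (inv_mul_cancel₀ hp).symm
      · simp [coord0, mk, div_eq_inv_mul]
    · simp only [coord0, mk, Quotient.liftOn_mk]
      simp only at hp
      field_simp
  right_inv' := by
    rintro ⟨z, x⟩ -
    simp [coord0, point0, mk]
  open_source := isOpen_U0
  open_target := isOpen_univ
  continuousOn_toFun := by
    rw [isQuotientMap_mk.continuousOn_isOpen_iff isOpen_U0]
    intro a ha
    have ha' : a.1.1.1 ≠ 0 := ha
    have : ContinuousAt (fun a : PreO2 => (a.1.1.2 / a.1.1.1, a.2 * a.1.1.1 ^ 2)) a := by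
      fun_prop (disch := assumption)
    exact this.continuousWithinAt
  continuousOn_invFun := continuous_point0.continuousOn

/-- The chart `[Z₀ : Z₁ ; t] ↦ (Z₀ / Z₁, t Z₁²)` on `Z₁ ≠ 0`. -/
noncomputable def chart1 : OpenPartialHomeomorph O2 (ℂ × ℂ) where
  toFun := coord1
  invFun := point1
  source := U1
  target := Set.univ
  map_source' := fun _ _ => Set.mem_univ _
  map_target' := fun _ _ => mk_mem_U1.2 one_ne_zero
  left_inv' := by
    intro p hp
    obtain ⟨⟨⟨Z, hZ⟩, t⟩, rfl⟩ := isQuotientMap_mk.surjective p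
    rw [mk_mem_U1] at hp
    refine mk_eq_mk.2 ⟨Z.2⁻¹, inv_ne_zero hp, ?_, ?_⟩
    · refine Prod.ext ?_ ?_
      · simp [coord1, mk, div_eq_inv_mul]
      · simpa using (inv_mul_cancel₀ hp).symm
    · simp only [coord1, mk, Quotient.liftOn_mk]
      simp only at hp
      field_simp
  right_inv' := by
    rintro ⟨z, x⟩ -
    simp [coord1, point1, mk]
  open_source := isOpen_U1
  open_target := isOpen_univ
  continuousOn_toFun := by
    rw [isQuotientMap_mk.continuousOn_isOpen_iff isOpen_U1]
    intro a ha
    have ha' : a.1.1.2 ≠ 0 := ha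
    have : ContinuousAt (fun a : PreO2 => (a.1.1.1 / a.1.1.2, a.2 * a.1.1.2 ^ 2)) a := by
      fun_prop (disch := assumption)
    exact this.continuousWithinAt
  continuousOn_invFun := continuous_point1.continuousOn

open Classical in
/-- The atlas of `O(-2)` consisting of the two standard charts. -/
noncomputable instance : ChartedSpace (ℂ × ℂ) O2 where
  atlas := {chart0, chart1}
  chartAt p := if p ∈ U0 then chart0 else chart1
  mem_chart_source p := by
    by_cases h : p ∈ U0
    · rw [if_pos h]; exact h
    · rw [if_neg h]; exact mem_U1_of_not_mem_U0 h
  chart_mem_atlas p := by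
    by_cases h : p ∈ U0
    · rw [if_pos h]; exact Or.inl rfl
    · rw [if_neg h]; exact Or.inr rfl

theorem mem_atlas_iff {e : OpenPartialHomeomorph O2 (ℂ × ℂ)} :
    e ∈ atlas (ℂ × ℂ) O2 ↔ e = chart0 ∨ e = chart1 := Iff.rfl

/-- Both changes of coordinates are `(z, ξ) ↦ (1 / z, z² ξ)`. -/
theorem coord1_point0 (x : ℂ × ℂ) : coord1 (point0 x) = (1 / x.1, x.2 * x.1 ^ 2) := rfl

theorem coord0_point1 (x : ℂ × ℂ) : coord0 (point1 x) = (1 / x.1, x.2 * x.1 ^ 2) := rfl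

theorem contDiffOn_transition :
    ContDiffOn ℂ ω (fun x : ℂ × ℂ => (1 / x.1, x.2 * x.1 ^ 2)) {x | x.1 ≠ 0} := by
  intro x hx
  have hx' : x.1 ≠ 0 := hx
  have : ContDiffAt ℂ ω (fun x : ℂ × ℂ => (1 / x.1, x.2 * x.1 ^ 2)) x := by
    fun_prop (disch := assumption)
  exact this.contDiffWithinAt

/-- `O(-2)` is a complex manifold of dimension two. -/
instance : IsManifold 𝓘(ℂ, ℂ × ℂ) ω O2 := by
  refine isManifold_of_contDiffOn _ _ _ ?_
  have same : ∀ e : OpenPartialHomeomorph O2 (ℂ × ℂ), ContDiffOn ℂ ω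
      (𝓘(ℂ, ℂ × ℂ) ∘ e.symm ≫ₕ e ∘ (𝓘(ℂ, ℂ × ℂ)).symm)
      ((𝓘(ℂ, ℂ × ℂ)).symm ⁻¹' (e.symm ≫ₕ e).source ∩ Set.range 𝓘(ℂ, ℂ × ℂ)) := by
    intro e
    refine contDiffOn_id.congr ?_
    rintro x ⟨hx, -⟩
    simp only [Set.mem_preimage, modelWithCornersSelf_coe_symm, id] at hx
    simpa using e.right_inv (by simpa using hx.1)
  intro e e' he he'
  rcases mem_atlas_iff.1 he with rfl | rfl <;> rcases mem_atlas_iff.1 he' with rfl | rfl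
  · exact same _
  · refine contDiffOn_transition.mono ?_
    rintro x ⟨hx, -⟩
    exact hx.2
  · refine contDiffOn_transition.mono ?_
    rintro x ⟨hx, -⟩
    exact hx.2
  · exact same _

end O2

/-! ### The Eguchi–Hanson metric -/

/-- Calabi's function `u` in complex dimension two over `ℂP¹`. -/
noncomputable def calabiFun (c x : ℝ) : ℝ :=
  (√(1 + c * x) - 1) - Real.log ((√(1 + c * x) + 1) / 2)

/-- The Kähler potential `log (1 + |z|²) + u ((1 + |z|²)² |ξ|²)` of the Eguchi–Hanson metric in
either of the two charts of `O(-2)`. -/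
noncomputable def eguchiHansonPotential (c : ℝ) (x : ℂ × ℂ) : ℝ :=
  Real.log (1 + ‖x.1‖ ^ 2) + calabiFun c ((1 + ‖x.1‖ ^ 2) ^ 2 * ‖x.2‖ ^ 2)

/-- The Eguchi–Hanson metric on `O(-2)`, with associated form `(i / 2π) ∂∂̄` of the potential. Mathlib
reads tangent vectors at `p` in the preferred chart at `p`. On the overlap of the two charts the two
potentials differ by the pluriharmonic function `log |z|²`. -/
noncomputable def eguchiHanson (c : ℝ) : MetricTensor (ℂ × ℂ) O2 :=
  fun p v w => potentialMetric (eguchiHansonPotential c) (chartAt (ℂ × ℂ) p p) v w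

/-! ### Power series with nonnegative coefficients and Pringsheim's theorem -/

section PowerSeries

open Complex ComplexOrder Filter Metric

/-! The obstruction already lives on the single fibre `z = 0`, where the potential is `m u(|ξ|²)`.
Near `ξ = 0` a Kähler immersion has a holomorphic lift `G`, and `log ‖G‖²` and `m u(|ξ|²)` are
potentials of the same metric. They differ by a harmonic function, the real part of a holomorphic
one, so rescaling `G` gives `K` with `‖K ξ‖² = exp (m u(|ξ|²))`
(`exists_holomorphic_norm_sq_eq_exp`). Averaging over circles, Parseval's identity makes `exp (m
u(t))` a power series in `t` with nonnegative coefficients (`exists_nonneg_hasSum_of_norm_sq_eq`).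

This is impossible (`not_hasSum_expCalabi_of_nonneg`). After scaling to `c = 1`, put `s = √(1 + y)`;
then `E = exp (m u)` is holomorphic for `Re y > -1`. With nonnegative coefficients, Pringsheim's
theorem pushes the radius of convergence beyond `1`, because `E` has no singularity at `y = 1`. So
the series is analytic at the branch point `-1` too. But `2 y E' = (s - 1) m E` gives `(m E + 2 y
E')² = (1 + y) (m E)²`, and at `-1` the left side vanishes to even order, the right side to odd
order. -/

/-- A power series with real coefficients which sums to an analytic function on an interval to the
right of `0` is its Taylor series. -/
theorem iteratedDeriv_eq_of_hasSum_Ioo {f : ℂ → ℂ} {b : ℕ → ℝ} {ε : ℝ} (hf : AnalyticAt ℂ f 0)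
    (hε : 0 < ε) (h : ∀ t ∈ Set.Ioo 0 ε, HasSum (fun n => (b n : ℂ) * (t : ℂ) ^ n) (f t)) (n : ℕ) :
    iteratedDeriv n f 0 = n.factorial * b n := by
  set p := FormalMultilinearSeries.ofScalars ℂ (fun n => (b n : ℂ)) with hp
  -- Convergence at the one point `ε / 2` forces the terms there to tend to `0`, which bounds the
  -- radius below.
  have hrad : 0 < p.radius := by
    have ht := (h (ε / 2) ⟨by positivity, by linarith⟩).summable.tendsto_atTop_zero.norm
    lift ε / 2 to NNReal using by positivity with t ht0
    have ht0' : 0 < t := by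
      have : (0 : ℝ) < t := by rw [ht0]; positivity
      exact_mod_cast this
    refine lt_of_lt_of_le (ENNReal.coe_pos.2 ht0') (p.le_radius_of_tendsto (l := 0) ?_)
    simpa [hp] using ht
  have hps := p.hasFPowerSeriesOnBall hrad
  have hfreq : ∃ᶠ z in 𝓝[≠] (0 : ℂ), p.sum z = f z := by
    have ht : Tendsto (fun t : ℝ => (t : ℂ)) (𝓝[>] 0) (𝓝[≠] 0) := by
      refine tendsto_nhdsWithin_iff.2 ⟨?_, ?_⟩
      · have : ContinuousAt (fun t : ℝ => (t : ℂ)) 0 := continuous_ofReal.continuousAt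
        simpa using this.mono_left nhdsWithin_le_nhds
      · filter_upwards [self_mem_nhdsWithin] with t ht
        simpa using ht.ne'
    refine ht.frequently (Eventually.frequently ?_)
    filter_upwards [Ioo_mem_nhdsGT hε] with t ht
    rw [FormalMultilinearSeries.sum, ← (h t ht).tsum_eq]
    refine tsum_congr fun n => ?_
    simp [hp, mul_comm]
  have heq : p.sum =ᶠ[𝓝 0] f :=
    (hps.analyticAt.frequently_eq_iff_eventually_eq hf).1 hfreq
  have h1 := (hps.hasFPowerSeriesAt.congr heq).eq_formalMultilinearSeries hf.hasFPowerSeriesAt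
  have h2 : (b n : ℂ) = iteratedDeriv n f 0 / n.factorial := by
    have := congrArg (fun q => q.coeff n) h1
    simpa [hp] using this
  rw [h2, mul_div_cancel₀]
  exact_mod_cast n.factorial_ne_zero

/-- Subtracting a Taylor polynomial from a function removes its derivatives of small order. -/
theorem iteratedDeriv_sub_sum_pow_zero {f : ℂ → ℂ} {b : ℕ → ℝ} (hf : AnalyticAt ℂ f 0)
    (hb : ∀ n, iteratedDeriv n f 0 = n.factorial * b n) (N n : ℕ) :
    iteratedDeriv n (fun z => f z - ∑ k ∈ Finset.range N, (b k : ℂ) * z ^ k) 0 =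
      if n < N then (0 : ℂ) else n.factorial * b n := by
  rw [iteratedDeriv_fun_sub hf.contDiffAt (by fun_prop),
    iteratedDeriv_fun_sum (fun i _ => by fun_prop)]
  simp only [iteratedDeriv_const_mul_field, iteratedDeriv_fun_pow_zero, hb]
  split_ifs with h
  · rw [Finset.sum_eq_single n]
    · simp [mul_comm]
    · intro k _ hk
      simp [hk.symm]
    · intro h'
      exact absurd (Finset.mem_range.2 h) h'
  · rw [Finset.sum_eq_zero, sub_zero]
    intro k hk
    have : n ≠ k := by
      rintro rfl
      exact h (Finset.mem_range.1 hk)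
    simp [this]

/-- **Pringsheim's theorem**: if the Taylor coefficients of `f` at `0` are nonnegative and `f` is
holomorphic on a disc around a point `x ≥ 0` of the disc of convergence, then the Taylor series
converges at all points `x + q` of the former disc with `q ≥ 0`. -/
theorem summable_coeff_of_differentiableOn_ball {f : ℂ → ℂ} {b : ℕ → ℝ} {r x ρ q : ℝ}
    (hb0 : ∀ n, 0 ≤ b n) (hb : ∀ n, iteratedDeriv n f 0 = n.factorial * b n)
    (hf : DifferentiableOn ℂ f (ball 0 r)) (hx : 0 ≤ x) (hxr : x < r)
    (hfx : DifferentiableOn ℂ f (ball (x : ℂ) ρ)) (hq : 0 ≤ q) (hqρ : q < ρ) :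
    Summable fun n => b n * (x + q) ^ n := by
  have hr : 0 < r := hx.trans_lt hxr
  have hfa : AnalyticOnNhd ℂ f (ball 0 r) := hf.analyticOnNhd isOpen_ball
  have hx_mem : (x : ℂ) ∈ ball (0 : ℂ) r := by simpa [abs_of_nonneg hx]
  -- The terms are nonnegative, so it suffices to bound the partial sums by `f (x + q)`, that is, to
  -- show that the remainder `g` is nonnegative at `x + q`. Positivity of derivatives is carried
  -- from `0` to `x`, then from `x` to `x + q`.
  refine summable_of_sum_range_le (c := (f ((x + q : ℝ) : ℂ)).re)
    (fun n => mul_nonneg (hb0 n) (by positivity)) fun N => ?_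
  set g : ℂ → ℂ := fun z => f z - ∑ k ∈ Finset.range N, (b k : ℂ) * z ^ k with hg
  have hpoly : Differentiable ℂ fun z : ℂ => ∑ k ∈ Finset.range N, (b k : ℂ) * z ^ k := by
    fun_prop
  have hg0 : DifferentiableOn ℂ g (ball 0 r) := hf.sub hpoly.differentiableOn
  have hgx : DifferentiableOn ℂ g (ball (x : ℂ) ρ) := hfx.sub hpoly.differentiableOn
  have hgd : ∀ n, 0 ≤ iteratedDeriv n g 0 := by
    intro n
    rw [hg, iteratedDeriv_sub_sum_pow_zero (hfa 0 (mem_ball_self hr)) hb]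
    split_ifs
    · exact le_rfl
    · have : 0 ≤ (n.factorial : ℝ) * b n := mul_nonneg (by positivity) (hb0 n)
      exact_mod_cast this
  have hgdx : ∀ n, 0 ≤ iteratedDeriv n g x := by
    intro n
    have hdn : DifferentiableOn ℂ (iteratedDeriv n g) (ball 0 r) := by
      rw [iteratedDeriv_eq_iterate]
      exact ((hg0.analyticOnNhd isOpen_ball).iterated_deriv n).differentiableOn
    refine hdn.nonneg_of_iteratedDeriv_nonneg (fun k => ?_) (by exact_mod_cast hx) hx_mem
    have := hgd (k + n)
    rwa [iteratedDeriv_eq_iterate, Function.iterate_add_apply, ← iteratedDeriv_eq_iterate,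
      ← iteratedDeriv_eq_iterate] at this
  have hmain : 0 ≤ g ((x + q : ℝ) : ℂ) := by
    refine hgx.nonneg_of_iteratedDeriv_nonneg hgdx (by exact_mod_cast (by linarith : x ≤ x + q)) ?_
    simpa [dist_eq, abs_of_nonneg hq]
  have hre := (Complex.le_def.1 hmain).1
  have hsum : (∑ k ∈ Finset.range N, (b k : ℂ) * ((x + q : ℝ) : ℂ) ^ k) =
      ((∑ k ∈ Finset.range N, b k * (x + q) ^ k : ℝ) : ℂ) := by push_cast; rfl
  simp only [hg, hsum, sub_re, ofReal_re, zero_re] at hre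
  linarith

end PowerSeries

/-! ### The branch point of `exp (m u)` at `-1` -/

section EguchiHansonFunction

open Complex ComplexOrder Filter Metric

/-- The principal branch of `√(1 + y)`. -/
noncomputable def sqrtOneAdd (y : ℂ) : ℂ := exp (log (1 + y) / 2)

/-- The holomorphic extension of `exp (m u)`, where `u` is Calabi's function for `c = 1`. -/
noncomputable def expCalabi (m : ℕ) (y : ℂ) : ℂ :=
  (2 * exp (sqrtOneAdd y - 1) / (sqrtOneAdd y + 1)) ^ m

theorem sqrtOneAdd_sq {y : ℂ} (hy : 0 < (1 + y).re) : sqrtOneAdd y ^ 2 = 1 + y := by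
  have h : 1 + y ≠ 0 := by rintro h; simp [h] at hy
  rw [sqrtOneAdd, ← exp_nat_mul, Nat.cast_ofNat, mul_div_cancel₀ _ two_ne_zero, exp_log h]

/-- Halving an argument in `(-π/2, π/2)` keeps the cosine positive. Hence `s + 1` has no zero on the
half-plane. -/
theorem sqrtOneAdd_re_pos {y : ℂ} (hy : 0 < (1 + y).re) : 0 < (sqrtOneAdd y).re := by
  have h := abs_lt.1 (abs_arg_lt_pi_div_two_iff.2 (Or.inl hy))
  have him : (log (1 + y) / 2).im = arg (1 + y) / 2 := by
    rw [← log_im]; simp [div_ofNat_im]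
  rw [sqrtOneAdd, exp_re, him]
  refine mul_pos (Real.exp_pos _) (Real.cos_pos_of_mem_Ioo ⟨?_, ?_⟩) <;>
    linarith [Real.pi_pos, h.1, h.2]

theorem sqrtOneAdd_add_one_ne_zero {y : ℂ} (hy : 0 < (1 + y).re) : sqrtOneAdd y + 1 ≠ 0 := by
  intro h
  have := congrArg re h
  simp only [add_re, one_re, zero_re] at this
  linarith [sqrtOneAdd_re_pos hy]

theorem sqrtOneAdd_ne_zero (y : ℂ) : sqrtOneAdd y ≠ 0 := exp_ne_zero _

theorem hasDerivAt_sqrtOneAdd {y : ℂ} (hy : 0 < (1 + y).re) :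
    HasDerivAt sqrtOneAdd (1 / (2 * sqrtOneAdd y)) y := by
  have h : 1 + y ≠ 0 := by rintro h; simp [h] at hy
  have h1 : HasDerivAt (fun y : ℂ => 1 + y) 1 y := (hasDerivAt_id y).const_add 1
  have h2 := ((h1.clog (Or.inl hy)).div_const 2).cexp
  refine h2.congr_deriv ?_
  change sqrtOneAdd y * _ = _
  rw [← sqrtOneAdd_sq hy]
  have := sqrtOneAdd_ne_zero y
  field_simp

/-- The logarithmic derivative is `m s' (1 - 1 / (s + 1)) = m s' s / (s + 1)`, and `s' = 1 / (2 s)`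
cancels the factor `s`. -/
theorem hasDerivAt_expCalabi (m : ℕ) {y : ℂ} (hy : 0 < (1 + y).re) :
    HasDerivAt (expCalabi m) (m * expCalabi m y / (2 * (sqrtOneAdd y + 1))) y := by
  have h0 := sqrtOneAdd_ne_zero y
  have h1 := sqrtOneAdd_add_one_ne_zero hy
  have hs := hasDerivAt_sqrtOneAdd hy
  have h2 := ((((hs.sub_const 1).cexp).const_mul 2).div (hs.add_const 1) h1).pow m
  refine h2.congr_deriv ?_
  rcases m with _ | m
  · simp
  · simp only [expCalabi, Nat.add_sub_cancel, Pi.div_apply]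
    rw [pow_succ _ m]
    generalize (2 * exp (sqrtOneAdd y - 1) / (sqrtOneAdd y + 1)) ^ m = A
    field_simp
    ring

/-- An algebraic differential equation of `expCalabi m`. -/
theorem expCalabi_equation (m : ℕ) {y : ℂ} (hy : 0 < (1 + y).re) :
    (m * expCalabi m y + 2 * y * deriv (expCalabi m) y) ^ 2 =
      (1 + y) * (m * expCalabi m y) ^ 2 := by
  have h1 := sqrtOneAdd_add_one_ne_zero hy
  have h2 : y = (sqrtOneAdd y - 1) * (sqrtOneAdd y + 1) := by
    linear_combination -sqrtOneAdd_sq hy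
  rw [(hasDerivAt_expCalabi m hy).deriv, ← sqrtOneAdd_sq hy]
  -- Since `y = (s - 1)(s + 1)`, the denominator cancels; adding `m E` leaves `s m E`, and squaring
  -- removes the root.
  have : 2 * y * (m * expCalabi m y / (2 * (sqrtOneAdd y + 1))) =
      (sqrtOneAdd y - 1) * (m * expCalabi m y) := by
    nth_rw 1 [h2]
    field_simp
  rw [this]
  ring

theorem expCalabi_zero (m : ℕ) : expCalabi m 0 = 1 := by
  simp [expCalabi, sqrtOneAdd]
  norm_num

theorem sqrtOneAdd_ofReal {y : ℝ} (hy : 0 < 1 + y) : sqrtOneAdd y = (√(1 + y) : ℝ) := by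
  rw [sqrtOneAdd, Real.sqrt_eq_rpow, Real.rpow_def_of_pos hy, ofReal_exp]
  push_cast [ofReal_log hy.le]
  ring_nf

theorem expCalabi_ofReal (m : ℕ) {c t : ℝ} (hy : 0 < 1 + c * t) :
    expCalabi m ((c * t : ℝ) : ℂ) = (Real.exp (m * calabiFun c t) : ℝ) := by
  have h : 0 < (√(1 + c * t) + 1) / 2 := by positivity
  have hR : Real.exp (m * calabiFun c t) =
      (2 * Real.exp (√(1 + c * t) - 1) / (√(1 + c * t) + 1)) ^ m := by
    rw [calabiFun, Real.exp_nat_mul, Real.exp_sub, Real.exp_log h]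
    congr 1
    field_simp
  rw [expCalabi, sqrtOneAdd_ofReal hy, hR]
  push_cast
  rfl

/-- A function `g` with `g² = (1 + y) h²` near `-1`, with `h` analytic and not locally zero, is not
analytic at `-1`. -/
theorem not_sq_eq_one_add_mul_sq {g h : ℂ → ℂ} (hg : AnalyticAt ℂ g (-1)) (hh : AnalyticAt ℂ h (-1))
    (hne : analyticOrderAt h (-1) ≠ ⊤) :
    ¬ (fun y => g y ^ 2) =ᶠ[𝓝 (-1)] fun y => (1 + y) * h y ^ 2 := by
  intro heq
  have h1 : analyticOrderAt (fun y : ℂ => 1 + y) (-1) = 1 := by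
    have : (fun y : ℂ => 1 + y) = fun y => y - (-1) := by ext; ring
    have h2 := analyticOrderAt_id_sub_const_self (𝕜 := ℂ) (c := -1)
    rw [this]
    exact h2
  have ha : AnalyticAt ℂ (fun y : ℂ => 1 + y) (-1) := by fun_prop
  have h3 := analyticOrderAt_congr heq
  have h4 : analyticOrderAt (fun y => g y ^ 2) (-1) = 2 • analyticOrderAt g (-1) :=
    analyticOrderAt_pow hg 2
  have h5 : analyticOrderAt (fun y => (1 + y) * h y ^ 2) (-1) =
      1 + 2 • analyticOrderAt h (-1) := by
    rw [← h1, ← analyticOrderAt_pow hh 2]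
    exact analyticOrderAt_mul ha (hh.pow 2)
  rw [h4, h5] at h3
  obtain ⟨k, hk⟩ := ENat.ne_top_iff_exists.1 hne
  rw [← hk] at h3
  -- Once both orders are known to be finite, `2 l = 1 + 2 k` is a parity contradiction in `ℕ`.
  have hgt : analyticOrderAt g (-1) ≠ ⊤ := by
    intro h
    rw [h] at h3
    have : ((1 + 2 * k : ℕ) : ℕ∞) = ⊤ := by
      push_cast
      simpa using h3.symm
    exact ENat.natCast_ne_top _ this
  obtain ⟨l, hl⟩ := ENat.ne_top_iff_exists.1 hgt
  rw [← hl] at h3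
  simp only [nsmul_eq_mul] at h3
  norm_cast at h3
  omega

/-- The Taylor coefficients of `expCalabi m` at `0` are not all nonnegative. -/
theorem not_hasSum_expCalabi_of_nonneg {m : ℕ} (hm : 0 < m) {b : ℕ → ℝ} (hb : ∀ n, 0 ≤ b n)
    {ε : ℝ} (hε : 0 < ε) :
    ¬ ∀ t ∈ Set.Ioo 0 ε, HasSum (fun n => (b n : ℂ) * (t : ℂ) ^ n) (expCalabi m t) := by
  intro h
  have hopen : IsOpen {y : ℂ | 0 < (1 + y).re} :=
    isOpen_lt continuous_const (by fun_prop)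
  have hd : DifferentiableOn ℂ (expCalabi m) {y : ℂ | 0 < (1 + y).re} := fun y hy =>
    (hasDerivAt_expCalabi m hy).differentiableAt.differentiableWithinAt
  have h0 : (0 : ℂ) ∈ {y : ℂ | 0 < (1 + y).re} := by simp
  have han : AnalyticAt ℂ (expCalabi m) 0 := hd.analyticAt (hopen.mem_nhds h0)
  have hcoeff := iteratedDeriv_eq_of_hasSum_Ioo han hε h
  have hball0 : ball (0 : ℂ) 1 ⊆ {y : ℂ | 0 < (1 + y).re} := by
    intro y hy
    have h1 := (abs_le.1 (abs_re_le_norm y)).1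
    have h2 : ‖y‖ < 1 := by simpa using hy
    simp only [Set.mem_ofPred_eq, add_re, one_re]
    linarith
  -- This disc touches the boundary of the half-plane at `-1` yet contains `5/4 = 1/2 + 3/4`, beyond
  -- the unit disc.
  have hball1 : ball ((1 / 2 : ℝ) : ℂ) (3 / 2) ⊆ {y : ℂ | 0 < (1 + y).re} := by
    intro y hy
    have h1 := (abs_le.1 (abs_re_le_norm (y - ((1 / 2 : ℝ) : ℂ)))).1
    have h2 : ‖y - ((1 / 2 : ℝ) : ℂ)‖ < 3 / 2 := by rwa [← dist_eq]
    simp only [sub_re, ofReal_re] at h1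
    simp only [Set.mem_ofPred_eq, add_re, one_re]
    linarith
  have hsum : Summable fun n => b n * (5 / 4 : ℝ) ^ n := by
    have := summable_coeff_of_differentiableOn_ball (x := 1 / 2) (q := 3 / 4) hb hcoeff
      (hd.mono hball0) (by norm_num) (by norm_num) (hd.mono hball1) (by norm_num) (by norm_num)
    norm_num at this ⊢
    exact this
  set p := FormalMultilinearSeries.ofScalars ℂ (fun n => (b n : ℂ)) with hp
  have hrad : ENNReal.ofReal (5 / 4) ≤ p.radius := by
    refine p.le_radius_of_summable_norm ?_
    refine hsum.congr fun n => ?_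
    rw [hp, FormalMultilinearSeries.ofScalars_norm, Real.coe_toNNReal _ (by norm_num), norm_real,
      Real.norm_of_nonneg (hb n)]
  have hps := (p.hasFPowerSeriesOnBall (lt_of_lt_of_le (by simp) hrad)).mono (by simp) hrad
  have hga : AnalyticOnNhd ℂ p.sum (ball 0 (5 / 4)) := by
    rw [← eball_ofReal]
    exact hps.analyticOnNhd
  have hpeq : p.sum =ᶠ[𝓝 0] expCalabi m := by
    have h1 : p = FormalMultilinearSeries.ofScalars ℂ
        (fun n => iteratedDeriv n (expCalabi m) 0 / n.factorial) := by
      rw [hp]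
      congr 1
      ext n
      rw [hcoeff, mul_div_cancel_left₀]
      exact_mod_cast n.factorial_ne_zero
    have h2 := han.hasFPowerSeriesAt
    rw [← h1] at h2
    filter_upwards [h2.eventually_hasSum, hps.hasFPowerSeriesAt.eventually_hasSum] with z hz hz'
    simpa using hz'.unique hz
  have hdeq : deriv p.sum =ᶠ[𝓝 0] deriv (expCalabi m) := hpeq.deriv
  have hE1 : AnalyticOnNhd ℂ (fun y => m * p.sum y + 2 * y * deriv p.sum y) (ball 0 (5 / 4)) := by
    intro y hy
    have h1 := hga y hy
    have h2 := h1.deriv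
    fun_prop
  have hE2 : AnalyticOnNhd ℂ (fun y => m * p.sum y) (ball 0 (5 / 4)) := by
    intro y hy
    have h1 := hga y hy
    fun_prop
  have hEL : AnalyticOnNhd ℂ (fun y => (m * p.sum y + 2 * y * deriv p.sum y) ^ 2)
      (ball 0 (5 / 4)) := hE1.pow 2
  have hER : AnalyticOnNhd ℂ (fun y => (1 + y) * (m * p.sum y) ^ 2) (ball 0 (5 / 4)) := by
    intro y hy
    have h1 := hga y hy
    fun_prop
  have hpre : IsPreconnected (ball (0 : ℂ) (5 / 4)) := (convex_ball _ _).isPreconnected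
  have hz : (0 : ℂ) ∈ ball (0 : ℂ) (5 / 4) := mem_ball_self (by norm_num)
  have hneg : (-1 : ℂ) ∈ ball (0 : ℂ) (5 / 4) := by simp; norm_num
  -- The equation holds near `0`, where the series equals `expCalabi m`; the identity theorem
  -- carries it to `-1`, where only the series is known to be analytic.
  have hEq : Set.EqOn (fun y => (m * p.sum y + 2 * y * deriv p.sum y) ^ 2)
      (fun y => (1 + y) * (m * p.sum y) ^ 2) (ball 0 (5 / 4)) := by
    refine hEL.eqOn_of_preconnected_of_eventuallyEq hER hpre hz ?_
    filter_upwards [hpeq, hdeq, hopen.mem_nhds h0] with y h1 h2 h3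
    rw [h1, h2]
    exact expCalabi_equation m h3
  refine not_sq_eq_one_add_mul_sq (hE1 _ hneg) (hE2 _ hneg) ?_
    (hEq.eventuallyEq_of_mem (isOpen_ball.mem_nhds hneg))
  -- The value `m ≠ 0` at the origin prevents `m E` from vanishing identically near `-1`.
  refine hE2.analyticOrderAt_ne_top_of_isPreconnected hpre hz hneg ?_
  have : m * p.sum 0 ≠ 0 := by
    rw [hpeq.eq_of_nhds, expCalabi_zero]
    simpa using hm.ne'
  rw [((hE2 0 hz).analyticOrderAt_eq_zero).2 this]
  exact ENat.zero_ne_top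

end EguchiHansonFunction

/-! ### Parseval's identity for Hilbert space valued functions -/

section Parseval

open Complex Filter Metric Real

variable {H : Type*} [NormedAddCommGroup H] [InnerProductSpace ℂ H] [CompleteSpace H]

/-- Cauchy's formula for the coefficients of a power series as circle averages. -/
theorem circleAverage_zpow_smul_eq_coeff {K : ℂ → H} {q : FormalMultilinearSeries ℂ ℂ H} {R r : ℝ}
    (hK : DifferentiableOn ℂ K (ball 0 R)) (hq : HasFPowerSeriesAt K q 0) (hr : 0 < r)
    (hrR : r < R) (n : ℕ) :
    circleAverage (fun z => z⁻¹ ^ n • K z) 0 r = q.coeff n := by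
  lift r to NNReal using hr.le
  have h1 : HasFPowerSeriesOnBall K (cauchyPowerSeries K 0 r) 0 r :=
    (hK.mono (closedBall_subset_ball hrR)).hasFPowerSeriesOnBall (by exact_mod_cast hr)
  have h2 := h1.hasFPowerSeriesAt.eq_formalMultilinearSeries hq
  rw [circleAverage_eq_circleIntegral (by exact_mod_cast hr.ne'), ← h2]
  have h3 := cauchyPowerSeries_apply K 0 r n 1
  have h4 : (cauchyPowerSeries K 0 r).coeff n = cauchyPowerSeries K 0 r n fun _ => 1 := rfl
  rw [h4, h3]
  simp [smul_smul, mul_comm]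

/-- **Parseval's identity** for Hilbert space valued holomorphic functions on a disc. -/
theorem hasSum_norm_coeff_sq {K : ℂ → H} {q : FormalMultilinearSeries ℂ ℂ H} {R r : ℝ}
    (hK : DifferentiableOn ℂ K (ball 0 R)) (hq : HasFPowerSeriesOnBall K q 0 (ENNReal.ofReal R))
    (hr : 0 < r) (hrR : r < R) :
    HasSum (fun n => ((‖q.coeff n‖ ^ 2 : ℝ) : ℂ) * ((r ^ 2 : ℝ) : ℂ) ^ n)
      (circleAverage (fun z => ((‖K z‖ ^ 2 : ℝ) : ℂ)) 0 r) := by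
  have hcirc : ∀ θ, circleMap 0 r θ ∈ ball (0 : ℂ) R := fun θ => by simpa [abs_of_pos hr]
  have hKc : Continuous fun θ => K (circleMap 0 r θ) :=
    hK.continuousOn.comp_continuous (continuous_circleMap 0 r) hcirc
  have hsummable : Summable fun n => ‖q.coeff n‖ * r ^ n := by
    lift r to NNReal using hr.le
    have : (r : ENNReal) < q.radius := by
      refine lt_of_lt_of_le ?_ hq.r_le
      rwa [← ENNReal.ofReal_coe_nnreal, ENNReal.ofReal_lt_ofReal_iff (hr.trans hrR)]
    have := q.summable_norm_mul_pow this
    simpa [FormalMultilinearSeries.norm_apply_eq_norm_coef] using this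
  obtain ⟨M, hM⟩ : ∃ M, ∀ θ ∈ Set.uIcc 0 (2 * π), ‖K (circleMap 0 r θ)‖ ≤ M :=
    isCompact_uIcc.exists_bound_of_continuousOn hKc.continuousOn
  -- Only the second slot of `⟨K, K⟩` is expanded, so a single series has to be integrated termwise.
  have key : HasSum
      (fun n => circleAverage (fun z => inner ℂ (K z) (z ^ n • q.coeff n)) 0 r)
      (circleAverage (fun z => inner ℂ (K z) (K z)) 0 r) := by
    simp only [circleAverage_def]
    refine HasSum.const_smul _ ?_
    refine intervalIntegral.hasSum_integral_of_dominated_convergence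
      (fun n _ => M * (‖q.coeff n‖ * r ^ n)) (fun n => ?_) (fun n => ?_) ?_ ?_ ?_
    · have : Continuous fun θ => inner ℂ (K (circleMap 0 r θ)) (circleMap 0 r θ ^ n • q.coeff n) := by
        exact hKc.inner (((continuous_circleMap 0 r).pow n).smul continuous_const)
      exact this.aestronglyMeasurable
    · refine Eventually.of_forall fun θ hθ => (norm_inner_le_norm _ _).trans ?_
      rw [norm_smul, norm_pow, norm_circleMap_zero, abs_of_pos hr, mul_comm (r ^ n)]
      exact mul_le_mul_of_nonneg_right (hM θ (Set.uIoc_subset_uIcc hθ)) (by positivity)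
    · exact Eventually.of_forall fun θ _ => hsummable.mul_left M
    · exact intervalIntegrable_const
    · refine Eventually.of_forall fun θ _ => ?_
      have h1 : circleMap 0 r θ ∈ eball (0 : ℂ) (ENNReal.ofReal R) := by
        rw [eball_ofReal]; exact hcirc θ
      have h2 := hq.hasSum h1
      rw [zero_add] at h2
      have h3 := (innerSL ℂ (K (circleMap 0 r θ))).hasSum h2
      simpa using h3
  -- On the circle `z = r² / z̄`, so `⟨K z, zⁿ qₙ⟩` is `r²ⁿ` times the conjugate of `⟨qₙ, z⁻ⁿ K z⟩`,
  -- whose average is given by Cauchy's formula.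
  have hterm : ∀ n, circleAverage (fun z => inner ℂ (K z) (z ^ n • q.coeff n)) 0 r =
      ((‖q.coeff n‖ ^ 2 : ℝ) : ℂ) * ((r ^ 2 : ℝ) : ℂ) ^ n := by
    intro n
    have hint : CircleIntegrable (fun z => z⁻¹ ^ n • K z) 0 r := by
      have : Continuous fun θ => (circleMap 0 r θ)⁻¹ ^ n • K (circleMap 0 r θ) := by
        have h0 : ∀ θ, circleMap 0 r θ ≠ 0 := fun θ => circleMap_ne_center hr.ne'
        exact (((continuous_circleMap 0 r).inv₀ h0).pow n).smul hKc
      exact this.intervalIntegrable _ _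
    let T : H →L[ℝ] ℂ := (((innerSL ℂ (q.coeff n)).restrictScalars ℝ))
    have h1 := (conjCLE.toContinuousLinearMap.comp T).circleAverage_comp_comm hint
    have h2 : Set.EqOn (fun z => inner ℂ (K z) (z ^ n • q.coeff n))
        (fun z => (((r ^ 2 : ℝ) : ℂ) ^ n) • ((conjCLE.toContinuousLinearMap.comp T) ∘
          fun z => z⁻¹ ^ n • K z) z) (sphere 0 |r|) := by
      intro z hz
      have hz' : ‖z‖ = r := by simpa [abs_of_pos hr] using hz
      have hz0 : z ≠ 0 := by rintro rfl; simp at hz'; exact hr.ne hz'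
      have hzz : ((r ^ 2 : ℝ) : ℂ) * (starRingEnd ℂ z)⁻¹ = z := by
        rw [← hz', ofReal_pow, ← mul_conj', mul_inv_cancel_right₀]
        simpa using hz0
      simp only [T, Function.comp, ContinuousLinearMap.comp_apply, inner_smul_right,
        ContinuousLinearMap.coe_restrictScalars', innerSL_apply_apply, smul_eq_mul,
        ContinuousLinearEquiv.coe_coe, conjCLE_apply, map_mul, map_pow, map_inv₀,
        inner_conj_symm]
      nth_rw 1 [← hzz]
      ring
    rw [circleAverage_congr_sphere h2, circleAverage_fun_smul, h1,
      circleAverage_zpow_smul_eq_coeff hK (hq.hasFPowerSeriesAt) hr hrR]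
    simp only [T, ContinuousLinearMap.comp_apply, ContinuousLinearMap.coe_restrictScalars',
      innerSL_apply_apply, ContinuousLinearEquiv.coe_coe, conjCLE_apply, inner_conj_symm,
      smul_eq_mul]
    rw [inner_self_eq_norm_sq_to_K]
    push_cast
    exact mul_comm _ _
  have hself : (fun z => ((‖K z‖ ^ 2 : ℝ) : ℂ)) = fun z => inner ℂ (K z) (K z) := by
    ext z
    rw [inner_self_eq_norm_sq_to_K]
    push_cast
    rfl
  rw [hself]
  simpa only [hterm] using key

/-- If the squared norm of a Hilbert space valued holomorphic function is radial, then it is a power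
series in `|ξ|²` with nonnegative coefficients. -/
theorem exists_nonneg_hasSum_of_norm_sq_eq {K : ℂ → H} {R : ℝ} (hR : 0 < R)
    (hK : DifferentiableOn ℂ K (ball 0 R)) {φ : ℝ → ℝ}
    (hφ : ∀ ξ ∈ ball (0 : ℂ) R, ‖K ξ‖ ^ 2 = φ (‖ξ‖ ^ 2)) :
    ∃ b : ℕ → ℝ, (∀ n, 0 ≤ b n) ∧ ∃ ε > 0, ∀ t ∈ Set.Ioo (0 : ℝ) ε,
      HasSum (fun n => (b n : ℂ) * (t : ℂ) ^ n) (φ t : ℂ) := by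
  have hR2 : 0 < R / 2 := by positivity
  have hq : HasFPowerSeriesOnBall K (cauchyPowerSeries K 0 (R / 2)) 0 (ENNReal.ofReal (R / 2)) := by
    have hlt : R / 2 < R := by linarith
    lift R / 2 to NNReal using hR2.le with R'
    simpa using (hK.mono (closedBall_subset_ball hlt)).hasFPowerSeriesOnBall
      (by exact_mod_cast hR2)
  -- The radius is halved so that the closed disc fits in the domain; it is squared because `t =
  -- |ξ|²`.
  refine ⟨fun n => ‖(cauchyPowerSeries K 0 (R / 2)).coeff n‖ ^ 2, fun n => by positivity,
    (R / 2) ^ 2, by positivity, fun t ht => ?_⟩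
  have hsq : √t ^ 2 = t := Real.sq_sqrt ht.1.le
  have hlt : √t < R / 2 := by
    rw [Real.sqrt_lt' hR2]; exact ht.2
  have h := hasSum_norm_coeff_sq (hK.mono (ball_subset_ball (by linarith))) hq
    (Real.sqrt_pos.2 ht.1) hlt
  rw [hsq] at h
  rwa [circleAverage_const_on_circle (a := (φ t : ℂ))] at h
  intro z hz
  have hz' : ‖z‖ = √t := by simpa [abs_of_nonneg (Real.sqrt_nonneg t)] using hz
  rw [hφ z (by simp [hz']; linarith), hz', hsq]

end Parseval

/-! ### Potentials restricted to complex curves -/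

section PotentialOnCurves

open Filter InnerProductSpace

variable {E : Type*} [NormedAddCommGroup E] [NormedSpace ℂ E]

theorem fderiv_fderiv_apply_eq {ψ : E → ℝ} {x : E} (hψ : ContDiffAt ℝ 2 ψ x) (v w : E) :
    fderiv ℝ (fderiv ℝ ψ) x v w = fderiv ℝ (fun z => fderiv ℝ ψ z w) x v := by
  have h : DifferentiableAt ℝ (fderiv ℝ ψ) x :=
    (hψ.fderiv_right (m := 1) (by norm_num)).differentiableAt (by norm_num)
  rw [fderiv_clm_apply h (differentiableAt_const w)]
  simp

/-- The metric with potential `φ ∘ G` on a complex curve `G` is the restriction of the metric with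
potential `φ`. -/
theorem potentialMetric_comp [CompleteSpace E] {φ : E → ℝ} {G : ℂ → E} {ξ : ℂ}
    (hG : ∀ᶠ z in 𝓝 ξ, DifferentiableAt ℂ G z) (hφ : ContDiffAt ℝ 2 φ (G ξ)) :
    potentialMetric (fun z => φ (G z)) ξ 1 1 =
      potentialMetric φ (G ξ) (deriv G ξ) (deriv G ξ) := by
  have hGa : AnalyticAt ℂ G ξ := Complex.analyticAt_iff_eventually_differentiableAt.2 hG
  have hGr : ContDiffAt ℝ 2 G ξ := hGa.contDiffAt.restrict_scalars ℝ
  have hψ : ContDiffAt ℝ 2 (fun z => φ (G z)) ξ := hφ.comp ξ hGr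
  have hφd : DifferentiableAt ℝ (fderiv ℝ φ) (G ξ) :=
    (hφ.fderiv_right (m := 1) (by norm_num)).differentiableAt (by norm_num)
  have hfd : ∀ g : ℂ → E, ∀ z, DifferentiableAt ℂ g z →
      HasFDerivAt g ((ContinuousLinearMap.toSpanSingleton ℂ (deriv g z)).restrictScalars ℝ) z :=
    fun g z hg => hg.hasDerivAt.hasFDerivAt.restrictScalars ℝ
  have hev : ∀ᶠ z in 𝓝 ξ, ∀ w : ℂ,
      fderiv ℝ (fun z => φ (G z)) z w = fderiv ℝ φ (G z) (w • deriv G z) := by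
    have h1 : ∀ᶠ z in 𝓝 ξ, ContDiffAt ℝ 2 φ (G z) :=
      hGa.continuousAt.eventually (hφ.eventually (by simp))
    filter_upwards [hG, h1] with z hz hz1 w
    have := ((hz1.differentiableAt (by norm_num)).hasFDerivAt.comp z (hfd G z hz)).fderiv
    rw [Function.comp_def] at this
    rw [this]
    simp
  -- The extra term is linear in `w²`, so the contributions of `w = 1` and `w = I` cancel.
  have key : ∀ w : ℂ, fderiv ℝ (fderiv ℝ (fun z => φ (G z))) ξ w w =
      fderiv ℝ (fderiv ℝ φ) (G ξ) (w • deriv G ξ) (w • deriv G ξ) +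
        fderiv ℝ φ (G ξ) ((w * w) • deriv (deriv G) ξ) := by
    intro w
    rw [fderiv_fderiv_apply_eq hψ]
    have h1 : (fun z => fderiv ℝ (fun z => φ (G z)) z w) =ᶠ[𝓝 ξ]
        fun z => fderiv ℝ φ (G z) (w • deriv G z) := hev.mono fun z hz => hz w
    rw [h1.fderiv_eq]
    have h2 : HasFDerivAt (fun z => fderiv ℝ φ (G z)) _ ξ :=
      hφd.hasFDerivAt.comp ξ (hfd G ξ hGa.differentiableAt)
    have h3 : HasFDerivAt (fun z => w • deriv G z) _ ξ :=
      (hfd (deriv G) ξ hGa.deriv.differentiableAt).const_smul w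
    rw [(h2.clm_apply h3).fderiv]
    simp [smul_smul, add_comm]
  have key1 := key 1
  have keyI := key Complex.I
  simp only [one_mul, one_smul] at key1
  rw [Complex.I_mul_I, neg_one_smul, map_neg] at keyI
  rw [potentialMetric, potentialMetric, smul_eq_mul, mul_one, key1, keyI]
  ring

/-- The directions `1` and `I` form an orthonormal real basis of `ℂ`. Equality of metrics on a curve
thus becomes harmonicity of the difference of potentials. -/
theorem potentialMetric_one_one_eq_laplacian (ψ : ℂ → ℝ) (ξ : ℂ) :
    potentialMetric ψ ξ 1 1 = 1 / (4 * Real.pi) * Laplacian.laplacian ψ ξ := by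
  rw [laplacian_eq_iteratedFDeriv_complexPlane]
  simp [potentialMetric, iteratedFDeriv_two_apply]

/-- Two potentials of the same metric on a complex curve differ by a harmonic function. -/
theorem harmonicAt_sub_of_potentialMetric_eq {ψ χ : ℂ → ℝ} {ξ : ℂ} (hψ : ContDiffAt ℝ 2 ψ ξ)
    (hχ : ContDiffAt ℝ 2 χ ξ)
    (h : ∀ᶠ z in 𝓝 ξ, potentialMetric ψ z 1 1 = potentialMetric χ z 1 1) :
    HarmonicAt (ψ - χ) ξ := by
  refine ⟨hψ.sub hχ, ?_⟩
  filter_upwards [h, hψ.eventually (by simp), hχ.eventually (by simp)] with z hz h1 h2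
  rw [potentialMetric_one_one_eq_laplacian, potentialMetric_one_one_eq_laplacian] at hz
  have hpi : (1 / (4 * Real.pi)) ≠ 0 := by positivity
  rw [h1.laplacian_sub h2, mul_left_cancel₀ hpi hz, sub_self, Pi.zero_apply]

theorem potentialMetric_const_mul {φ : E → ℝ} {x : E} (hφ : ContDiffAt ℝ 2 φ x) (a : ℝ) (v w : E) :
    potentialMetric (fun y => a * φ y) x v w = a * potentialMetric φ x v w := by
  have h : fderiv ℝ (fun y => a * φ y) =ᶠ[𝓝 x] fun y => a • fderiv ℝ φ y := by
    filter_upwards [hφ.eventually (by simp)] with y hy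
    exact fderiv_const_mul (hy.differentiableAt (by norm_num)) a
  have hd : DifferentiableAt ℝ (fderiv ℝ φ) x :=
    (hφ.fderiv_right (m := 1) (by norm_num)).differentiableAt (by norm_num)
  rw [potentialMetric, potentialMetric, h.fderiv_eq, fderiv_fun_const_smul hd]
  simp
  ring

end PotentialOnCurves

/-! ### Normalising the lift of a holomorphic curve -/

section CurvesInProjectiveSpace

open Filter InnerProductSpace Metric

variable {H : Type*} [NormedAddCommGroup H] [InnerProductSpace ℂ H]

theorem contDiffAt_log_norm_sq {Z : H} (hZ : Z ≠ 0) :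
    ContDiffAt ℝ 2 (fun Y : H => Real.log (‖Y‖ ^ 2)) Z :=
  (contDiff_norm_sq ℂ).contDiffAt.log (by simpa using hZ)

/-- If the holomorphic curve `G` pulls the Fubini–Study metric back to the metric with potential
`ψ`, then it has a lift to `H` whose squared norm is `exp ψ`. -/
theorem exists_holomorphic_norm_sq_eq_exp [CompleteSpace H] {G : ℂ → H} {ψ : ℂ → ℝ}
    (hG : ∀ᶠ ξ in 𝓝 0, DifferentiableAt ℂ G ξ ∧ G ξ ≠ 0) (hψ : ContDiff ℝ 2 ψ)
    (h : ∀ᶠ ξ in 𝓝 0, fubiniStudy (G ξ) (deriv G ξ) (deriv G ξ) = potentialMetric ψ ξ 1 1) :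
    ∃ (K : ℂ → H) (R : ℝ), 0 < R ∧ DifferentiableOn ℂ K (ball 0 R) ∧
      ∀ ξ ∈ ball 0 R, ‖K ξ‖ ^ 2 = Real.exp (ψ ξ) := by
  have hGd : ∀ᶠ ξ in 𝓝 0, ∀ᶠ z in 𝓝 ξ, DifferentiableAt ℂ G z :=
    (hG.mono fun _ h => h.1).eventually_nhds
  have hharm : HarmonicAt ((fun ξ => Real.log (‖G ξ‖ ^ 2)) - ψ) 0 := by
    have hG0 := hG.self_of_nhds
    have hGa : AnalyticAt ℂ G 0 :=
      Complex.analyticAt_iff_eventually_differentiableAt.2 (hG.mono fun _ h => h.1)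
    refine harmonicAt_sub_of_potentialMetric_eq ?_ hψ.contDiffAt ?_
    · exact (contDiffAt_log_norm_sq hG0.2).comp 0 (hGa.contDiffAt.restrict_scalars ℝ)
    · filter_upwards [hG, hGd, h] with ξ h1 h2 h3
      rw [← h3]
      exact potentialMetric_comp h2 (contDiffAt_log_norm_sq h1.2)
  obtain ⟨R, hR, hball⟩ := Metric.eventually_nhds_iff_ball.1 (hG.and hharm.eventually)
  obtain ⟨k, hk, hkre⟩ :=
    HarmonicOnNhd.exists_analyticOnNhd_ball_re_eq (fun ξ hξ => (hball ξ hξ).2)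
  -- Here `Re k = log ‖G‖² - ψ`, so the factor `exp (-k / 2)` multiplies `‖G‖²` by `exp (ψ - log
  -- ‖G‖²)`.
  refine ⟨fun ξ => Complex.exp (-(k ξ / 2)) • G ξ, R, hR, ?_, ?_⟩
  · intro ξ hξ
    have h1 := (hk ξ hξ).differentiableAt
    have h2 := (hball ξ hξ).1.1
    exact ((h1.div_const 2).neg.cexp.smul h2).differentiableWithinAt
  · intro ξ hξ
    have h1 := hkre hξ
    have h2 : 0 < ‖G ξ‖ ^ 2 := by
      have := norm_pos_iff.2 (hball ξ hξ).1.2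
      positivity
    simp only [Pi.sub_apply] at h1
    have h3 : ψ ξ = -(k ξ).re + Real.log (‖G ξ‖ ^ 2) := by linarith
    rw [h3, Real.exp_add, Real.exp_log h2, norm_smul, Complex.norm_exp, mul_pow, ← Real.exp_nat_mul]
    congr 2
    simp only [Complex.neg_re, Complex.div_ofNat_re]
    push_cast
    ring

end CurvesInProjectiveSpace

/-! ### Restriction to the fibre `z = 0` and conclusion -/

section Fibre

open Filter Metric

theorem contDiff_eguchiHansonPotential {c : ℝ} (hc : 0 < c) :
    ContDiff ℝ 2 (eguchiHansonPotential c) := by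
  have h1 : ContDiff ℝ 2 fun x : ℂ × ℂ => ‖x.1‖ ^ 2 := contDiff_fst.norm_sq ℂ
  have h2 : ContDiff ℝ 2 fun x : ℂ × ℂ => ‖x.2‖ ^ 2 := contDiff_snd.norm_sq ℂ
  have h3 : ContDiff ℝ 2 fun x : ℂ × ℂ => √(1 + c * ((1 + ‖x.1‖ ^ 2) ^ 2 * ‖x.2‖ ^ 2)) := by
    refine ContDiff.sqrt (by fun_prop) fun x => ?_
    positivity
  have h4 : ContDiff ℝ 2 fun x : ℂ × ℂ => Real.log (1 + ‖x.1‖ ^ 2) := by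
    refine ContDiff.log (by fun_prop) fun x => ?_
    positivity
  have h5 : ContDiff ℝ 2 fun x : ℂ × ℂ =>
      Real.log ((√(1 + c * ((1 + ‖x.1‖ ^ 2) ^ 2 * ‖x.2‖ ^ 2)) + 1) / 2) := by
    refine ContDiff.log (by fun_prop) fun x => ?_
    positivity
  exact h4.add ((h3.sub contDiff_const).sub h5)

theorem eguchiHansonPotential_fibre (c : ℝ) (ξ : ℂ) :
    eguchiHansonPotential c (0, ξ) = calabiFun c (‖ξ‖ ^ 2) := by
  simp [eguchiHansonPotential]

namespace O2

theorem point0_mem_U0 (x : ℂ × ℂ) : point0 x ∈ U0 := mk_mem_U0.2 one_ne_zero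

theorem chartAt_point0 (x : ℂ × ℂ) : chartAt (ℂ × ℂ) (point0 x) = chart0 :=
  if_pos (point0_mem_U0 x)

theorem chart0_point0 (x : ℂ × ℂ) : chart0 (point0 x) = x := chart0.right_inv (Set.mem_univ x)

variable {H : Type*} [NormedAddCommGroup H] [NormedSpace ℂ H]

/-- The preferred chart is `chart0` at every point of `U0`, so manifold derivatives along the fibre
are ordinary derivatives in `(z, ξ)`. -/
theorem writtenInExtChartAt_point0 (F : O2 → H) (x : ℂ × ℂ) :
    writtenInExtChartAt 𝓘(ℂ, ℂ × ℂ) 𝓘(ℂ, H) (point0 x) F = fun y => F (point0 y) := by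
  ext y
  simp [writtenInExtChartAt, extChartAt, chartAt_point0]
  rfl

theorem extChartAt_point0 (x : ℂ × ℂ) :
    extChartAt 𝓘(ℂ, ℂ × ℂ) (point0 x) (point0 x) = x := by
  simp [extChartAt, chartAt_point0, chart0_point0]

theorem _root_.MDifferentiableAt.differentiableAt_comp_point0 {F : O2 → H} {x : ℂ × ℂ}
    (hF : MDifferentiableAt 𝓘(ℂ, ℂ × ℂ) 𝓘(ℂ, H) F (point0 x)) :
    DifferentiableAt ℂ (fun y => F (point0 y)) x := by
  have h := ((mdifferentiableAt_iff _ _).1 hF).2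
  rwa [writtenInExtChartAt_point0, extChartAt_point0, modelWithCornersSelf_coe, Set.range_id,
    differentiableWithinAt_univ] at h

theorem mfderiv_point0 {F : O2 → H} {x : ℂ × ℂ}
    (hF : MDifferentiableAt 𝓘(ℂ, ℂ × ℂ) 𝓘(ℂ, H) F (point0 x)) (v : ℂ × ℂ) :
    mfderiv 𝓘(ℂ, ℂ × ℂ) 𝓘(ℂ, H) F (point0 x) v = fderiv ℂ (fun y => F (point0 y)) x v := by
  rw [hF.mfderiv, writtenInExtChartAt_point0, extChartAt_point0, modelWithCornersSelf_coe,
    Set.range_id, fderivWithin_univ]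
  rfl

end O2

variable {H : Type*} [NormedAddCommGroup H] [InnerProductSpace ℂ H] [CompleteSpace H]

/-- Only completeness of `H` matters, so finite `N` and `ℓ²(ℂ)` are treated together. -/
theorem not_isKahlerImmersion_eguchiHanson {c : ℝ} (hc : 0 < c) {m : ℕ} (hm : 0 < m)
    (f : O2 → Projectivization ℂ H) : ¬ IsKahlerImmersion ((m : ℝ) • eguchiHanson c) f := by
  intro hf
  obtain ⟨F, hF⟩ := hf.holomorphic (O2.point0 (0, 0))
  have hι : Continuous fun ξ : ℂ => O2.point0 (0, ξ) := O2.continuous_point0.comp (by fun_prop)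
  have hι0 : Tendsto (fun ξ : ℂ => O2.point0 (0, ξ)) (𝓝 0) (𝓝 (O2.point0 (0, 0))) :=
    hι.tendsto 0
  have hlift : ∀ᶠ ξ in 𝓝 (0 : ℂ), IsHolomorphicLift (ℂ × ℂ) f F (O2.point0 (0, ξ)) :=
    hι0.eventually hF.eventually_nhds
  set ψ : ℂ → ℝ := fun ξ => m * eguchiHansonPotential c (0, ξ) with hψ
  have hpair : ∀ ξ : ℂ, HasDerivAt (fun ξ : ℂ => ((0, ξ) : ℂ × ℂ)) (0, 1) ξ := fun ξ =>
    (hasDerivAt_const ξ 0).prodMk (hasDerivAt_id ξ)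
  have hEH := contDiff_eguchiHansonPotential hc
  have hcomp : ContDiff ℝ 2 fun ξ : ℂ => eguchiHansonPotential c (0, ξ) :=
    hEH.comp (contDiff_const.prodMk contDiff_id)
  have hψmetric : ∀ ξ, potentialMetric ψ ξ 1 1 =
      m * potentialMetric (eguchiHansonPotential c) (0, ξ) (0, 1) (0, 1) := by
    intro ξ
    rw [hψ, potentialMetric_const_mul hcomp.contDiffAt, potentialMetric_comp
      (G := fun ξ : ℂ => ((0, ξ) : ℂ × ℂ)) (Eventually.of_forall fun z => (hpair z).differentiableAt)
      hEH.contDiffAt, (hpair ξ).deriv]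
  have hderiv : ∀ ξ, IsHolomorphicLift (ℂ × ℂ) f F (O2.point0 (0, ξ)) →
      HasDerivAt (fun ξ => F (O2.point0 (0, ξ)))
        (mfderiv 𝓘(ℂ, ℂ × ℂ) 𝓘(ℂ, H) F (O2.point0 (0, ξ)) ((0, 1) : ℂ × ℂ)) ξ := by
    intro ξ hξ
    have h1 := hξ.self_of_nhds.1
    have h2 := h1.differentiableAt_comp_point0.hasFDerivAt.comp_hasDerivAt ξ (hpair ξ)
    rw [← O2.mfderiv_point0 h1] at h2
    exact h2
  obtain ⟨K, R, hR, hK, hKnorm⟩ := exists_holomorphic_norm_sq_eq_exp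
    (G := fun ξ => F (O2.point0 (0, ξ))) (ψ := ψ)
    (hlift.mono fun ξ hξ => ⟨(hderiv ξ hξ).differentiableAt, hξ.self_of_nhds.2.1⟩)
    (contDiff_const.mul hcomp)
    (by
      filter_upwards [hlift] with ξ hξ
      have h1 := hf.isometric _ F hξ ((0, 1) : ℂ × ℂ) ((0, 1) : ℂ × ℂ)
      rw [(hderiv ξ hξ).deriv, hψmetric]
      refine h1.trans ?_
      change (m : ℝ) * potentialMetric (eguchiHansonPotential c)
        (chartAt (ℂ × ℂ) (O2.point0 (0, ξ)) (O2.point0 (0, ξ))) (0, 1) (0, 1) = _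
      rw [O2.chartAt_point0, O2.chart0_point0])
  obtain ⟨b, hb, ε, hε, hsum⟩ := exists_nonneg_hasSum_of_norm_sq_eq hR hK
    (φ := fun t => Real.exp (m * calabiFun c t)) fun ξ hξ => by
      rw [hKnorm ξ hξ, hψ]
      simp only [eguchiHansonPotential_fibre]
  -- Substituting `t / c` for `t` reduces to `c = 1`; dividing by `cⁿ > 0` keeps the coefficients
  -- nonnegative.
  refine not_hasSum_expCalabi_of_nonneg hm (b := fun n => b n / c ^ n)
    (fun n => div_nonneg (hb n) (by positivity)) (mul_pos hc hε) fun t ht => ?_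
  have ht' : t / c ∈ Set.Ioo 0 ε :=
    ⟨div_pos ht.1 hc, by rw [div_lt_iff₀ hc, mul_comm]; exact ht.2⟩
  have h1 : c * (t / c) = t := mul_div_cancel₀ t hc.ne'
  have h2 := expCalabi_ofReal m (c := c) (t := t / c) (by rw [h1]; linarith [ht.1])
  rw [h1] at h2
  rw [h2]
  refine (hsum _ ht').congr_fun fun n => ?_
  push_cast
  ring

end Fibre

theorem mainTheorem2 (c : ℝ) (hc : 0 < c) (m : ℕ) (hm : 0 < m) :
    ¬ ProjectivelyInduced ((m : ℝ) • eguchiHanson c) := by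
  rintro (⟨N, f, hf⟩ | ⟨f, hf⟩)
  · exact not_isKahlerImmersion_eguchiHanson hc hm f hf
  · exact not_isKahlerImmersion_eguchiHanson hc hm f hf
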